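/- All graphs are finite and simple. An \emph{oriented graph} is a finite digraph without loops and without directed cycles of length $2$. In an oriented graph $D$, $N^+(x)$ is the set of out-neighbors of $x$, and $N^{++}(x)$ is the set of vertices, other than $x$ and the members of $N^+(x)$, that are out-neighbors of a vertex in $N^+(x)$. A \emph{missing edge} of $D$ is a pair $xy$ of distinct vertices with neither $(x,y)$ nor $(y,x)$ an arc of $D$. For a graph $G$, we say that $D$ \emph{is missing} $G$ if $V(G)\subseteq V(D)$ and the missing edges of $D$ are exactly the edges of $G$; all vertices of $D$ incident to no edge of $G$ are then joined to every other vertex of $D$, and $D$ may have vertices outside $V(G)$. A missing edge $x_1y_1$ \emph{loses to} a missing edge $x_2y_2$ if, for some naming of their end vertices, $(x_1,x_2)$ and $(y_1,y_2)$ are arcs of $D$, $y_2\notin N^+(x_1)\cup N^{++}(x_1)$ and $x_2\notin N^+(y_1)\cup N^{++}(y_1)$. The \emph{dependency digraph} $\Delta_D$ has the missing edges of $D$ as its vertices, with an arc from $e$ to $e'$ if and only if $e$ loses to $e'$. A \emph{chair} is the graph on five distinct vertices $x,y,z,t,v$ whose edges are exactly $xy,yz,zt,zv$. A \emph{comb}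 is a graph having no induced subgraph isomorphic to $C_4$, $\overline{C_4}$, $C_5$, the chair, or the complement of the chair. \textbf{Theorem.} Let $G$ be a graph having neither an induced $C_4$ nor an induced $C_5$. Then the following are equivalent: (a) for every oriented graph $D$ missing $G$, the dependency digraph $\Delta_D$ is a disjoint union of directed paths (a single vertex counts as a directed path; the empty digraph is allowed); (b) $G$ is a comb. -/

import Mathlib

open scoped SimpleGraph

universe u v

namespace MissingComb

/-- The chair: five vertices `x = 0`, `y = 1`, `z = 2`, `t = 3`, `v = 4` with exactly the
four edges `xy`, `yz`, `zt`, `zv`. -/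
def chair : SimpleGraph (Fin 5) :=
  SimpleGraph.fromEdgeSet {s(0, 1), s(1, 2), s(2, 3), s(2, 4)}

/-- Combs are the graphs having no induced `C₄`, complement of `C₄`, `C₅`, chair or complement of
the chair. -/
structure IsComb {V : Type u} (G : SimpleGraph V) : Prop where
  noC4 : ¬ SimpleGraph.cycleGraph 4 ⊴ G
  noCoC4 : ¬ (SimpleGraph.cycleGraph 4)ᶜ ⊴ G
  noC5 : ¬ SimpleGraph.cycleGraph 5 ⊴ G
  noChair : ¬ chair ⊴ G
  noCoChair : ¬ chairᶜ ⊴ G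

/-- An oriented graph is a digraph without loops and without digons. -/
def IsOriented {W : Type u} (D : Digraph W) : Prop :=
  (∀ x, ¬ D.Adj x x) ∧ ∀ x y, D.Adj x y → ¬ D.Adj y x

/-- The first out-neighborhood `N⁺(x)`. -/
def outNbr {W : Type u} (D : Digraph W) (x : W) : Set W :=
  {y | D.Adj x y}

/-- The second out-neighborhood `N⁺⁺(x)`: out-neighbors of out-neighbors of `x`, excluding `x`
and the out-neighbors of `x`. -/
def secondOutNbr {W : Type u} (D : Digraph W) (x : W) : Set W :=
  {y | y ≠ x ∧ y ∉ outNbr D x ∧ ∃ u ∈ outNbr D x, y ∈ outNbr D u}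

/-- The graph of all missing edges of `D`: pairs of distinct vertices that no arc joins. -/
def missingGraph {W : Type u} (D : Digraph W) : SimpleGraph W where
  Adj x y := x ≠ y ∧ ¬ D.Adj x y ∧ ¬ D.Adj y x
  symm := ⟨fun _ _ h => ⟨h.1.symm, h.2.2, h.2.1⟩⟩
  loopless := ⟨fun _ h => h.1 rfl⟩

/-- `D` is missing `G`, where `V(G)` is placed in `V(D)` by the injection `f`: the missing edges
of `D` are exactly the edges of `G`. All vertices of `D` that are incident to no edge of `G`
(in particular those outside `V(G)`) are whole. -/
def IsMissing {V : Type u} {W : Type v} (D : Digraph W) (G : SimpleGraph V) (f : V ↪ W) : Prop :=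
  missingGraph D = G.map f

/-- The missing edge `e₁` loses to the missing edge `e₂`: for some naming `e₁ = x₁y₁`,
`e₂ = x₂y₂` of the end vertices, `x₁ → x₂`, `y₂ ∉ N⁺(x₁) ∪ N⁺⁺(x₁)`, `y₁ → y₂` and
`x₂ ∉ N⁺(y₁) ∪ N⁺⁺(y₁)`. -/
def LosesTo {W : Type u} (D : Digraph W) (e₁ e₂ : Sym2 W) : Prop :=
  ∃ x₁ y₁ x₂ y₂ : W, e₁ = s(x₁, y₁) ∧ e₂ = s(x₂, y₂) ∧
    D.Adj x₁ x₂ ∧ y₂ ∉ outNbr D x₁ ∪ secondOutNbr D x₁ ∧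
    D.Adj y₁ y₂ ∧ x₂ ∉ outNbr D y₁ ∪ secondOutNbr D y₁

/-- The dependency digraph of `D`: its vertices are the missing edges of `D`, and its arcs are
given by the losing relation. -/
def dependencyDigraph {W : Type u} (D : Digraph W) : Digraph (missingGraph D).edgeSet where
  Adj e₁ e₂ := LosesTo D e₁ e₂

/-- `H` is a disjoint union of directed paths: there is a set of nonempty duplicate-free lists of
vertices such that every vertex lies on exactly one of them, and the arcs of `H` are exactly the
pairs of consecutive entries of these lists. A path may consist of a single vertex. -/
def IsDisjointUnionOfPaths {α : Type u} (H : Digraph α) : Prop :=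
  ∃ P : Set (List α),
    (∀ p ∈ P, p ≠ [] ∧ p.Nodup) ∧
    (∀ a : α, ∃! p : List α, p ∈ P ∧ a ∈ p) ∧
    (∀ a b : α, H.Adj a b ↔ ∃ p ∈ P, [a, b] <:+: p)

end MissingComb

/-!
Write `M` for the graph of missing edges of an oriented graph `D`.

If `M` is a comb and the missing edge `e₁` loses to `e₂`, then, as `C₄` and `2K₂` are excluded, the
four end vertices induce a path `a b c d` of `M` with `e₁ = ab`, `e₂ = cd`, and `D` has the arcs
`b → d`, `a → c`, `d → a` (`LosesTo.exists_losesAlong`). The exclusion of `C₄`, `2K₂`, `C₅` makes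
the ends of an induced `P₄` simplicial and pairwise nonadjacent in `M`, while its inner vertices are
not simplicial; so each edge of a losing walk has a well-defined simplicial end. Two edges to which
`e₁` loses, or two edges losing to `e₂`, produce an induced chair or co-chair, or else a directed
2-path forbidden by the losing relation (`LosesAlong.out_unique`, `LosesAlong.in_unique`). Finally,
along a losing walk the simplicial end of the last edge always dominates that of the first edge
(`exists_adj_of_transGen`), so there are no directed cycles. A finite digraph with these three
properties is the disjoint union of its maximal chains (`isDisjointUnionOfPaths_of_acyclic`).

Conversely, if `G` contains an induced `2K₂`, chair or co-chair, its vertices are oriented so that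
two missing edges lose to each other, or one missing edge loses to two others. The remaining
vertices of `G` dominate these few vertices wherever the pair is not an edge of `G`, so they lie on
no out-walk starting there and do not disturb the losing relation (`exists_extension`).
-/

namespace MissingComb

/-! ### Disjoint unions of directed paths -/

/-- A list is a final chain of `R` if consecutive entries are related by `R` and nothing can be
appended to it. -/
def IsFinalChain {α : Type u} (R : α → α → Prop) (l : List α) : Prop :=
  l.IsChain R ∧ ∀ x ∈ l.getLast?, ∀ b, ¬ R x b

lemma IsFinalChain.cons_cons_iff {α : Type u} {R : α → α → Prop} {a b : α} {l : List α} :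
    IsFinalChain R (a :: b :: l) ↔ R a b ∧ IsFinalChain R (b :: l) := by
  simp [IsFinalChain, List.isChain_cons_cons, and_assoc]

lemma isFinalChain_singleton_iff {α : Type u} {R : α → α → Prop} {a : α} :
    IsFinalChain R [a] ↔ ∀ b, ¬ R a b := by
  simp [IsFinalChain]

lemma wellFounded_swap_of_acyclic {α : Type u} [Finite α] {R : α → α → Prop}
    (acyc : ∀ a, ¬ Relation.TransGen R a a) : WellFounded (fun a b => R b a) := by
  have : IsTrans α (fun a b => Relation.TransGen R b a) := ⟨fun _ _ _ h h' => h'.trans h⟩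
  have : Std.Irrefl (fun a b => Relation.TransGen R b a) := ⟨acyc⟩
  have wf : WellFounded (fun a b => Relation.TransGen R b a) :=
    Finite.wellFounded_of_trans_of_irrefl _
  exact Subrelation.wf (fun h => Relation.TransGen.single h) wf

lemma exists_isFinalChain_cons {α : Type u} [Finite α] {R : α → α → Prop}
    (acyc : ∀ a, ¬ Relation.TransGen R a a) (a : α) : ∃ l, IsFinalChain R (a :: l) := by
  induction a using (wellFounded_swap_of_acyclic acyc).induction with
  | _ a ih =>
    by_cases h : ∃ b, R a b
    · obtain ⟨b, hb⟩ := h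
      obtain ⟨l, hl⟩ := ih b hb
      exact ⟨b :: l, IsFinalChain.cons_cons_iff.2 ⟨hb, hl⟩⟩
    · exact ⟨[], isFinalChain_singleton_iff.2 (by simpa using h)⟩

lemma IsFinalChain.cons_unique {α : Type u} {R : α → α → Prop}
    (out : ∀ a b c, R a b → R a c → b = c) :
    ∀ {l l' : List α} {a : α}, IsFinalChain R (a :: l) → IsFinalChain R (a :: l') → l = l'
  | [], [], _, _, _ => rfl
  | [], b :: _, _, h, h' =>
    (isFinalChain_singleton_iff.1 h b (cons_cons_iff.1 h').1).elim
  | b :: _, [], _, h, h' =>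
    (isFinalChain_singleton_iff.1 h' b (cons_cons_iff.1 h).1).elim
  | b :: l, c :: l', a, h, h' => by
    rw [cons_cons_iff] at h h'
    obtain rfl := out a b c h.1 h'.1
    rw [cons_unique out h.2 h'.2]

/-- A list that is a final chain of `R` read forwards, and of the opposite relation read backwards,
is a maximal chain of `R`. Both conditions can be checked starting from any one entry `a`. -/
lemma isFinalChain_append_cons {α : Type u} {R : α → α → Prop} {s t : List α} {a : α} :
    (IsFinalChain R (s ++ a :: t) ∧ IsFinalChain (fun x y => R y x) (s ++ a :: t).reverse) ↔
      IsFinalChain R (a :: t) ∧ IsFinalChain (fun x y => R y x) (a :: s.reverse) := by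
  have h₁ : a :: s.reverse = (s ++ [a]).reverse := by simp
  have h₂ : (s ++ a :: t).getLast? = (a :: t).getLast? := by
    simp [List.getLast?_append, List.getLast?_cons]
  have h₃ : (s ++ a :: t).head? = (s ++ [a]).head? := by cases s <;> simp
  have h₄ : (s ++ a :: t).IsChain R ↔ (s ++ [a]).IsChain R ∧ (a :: t).IsChain R :=
    List.isChain_split
  simp only [IsFinalChain, h₁, List.isChain_reverse, List.getLast?_reverse, h₂, h₃, h₄]
  tauto

/-- A finite digraph with in-degrees and out-degrees at most one and without directed cycles is a
disjoint union of directed paths, namely of its maximal chains. -/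
lemma isDisjointUnionOfPaths_of_acyclic {α : Type u} [Finite α] (H : Digraph α)
    (out : ∀ a b c, H.Adj a b → H.Adj a c → b = c)
    (inn : ∀ a b c, H.Adj b a → H.Adj c a → b = c)
    (acyc : ∀ a, ¬ Relation.TransGen H.Adj a a) : IsDisjointUnionOfPaths H := by
  have acyc' : ∀ a, ¬ Relation.TransGen (fun x y => H.Adj y x) a a := fun a h =>
    acyc a (Relation.transGen_swap.1 h)
  have ex : ∀ a, ∃ s t, IsFinalChain H.Adj (s ++ a :: t) ∧
      IsFinalChain (fun x y => H.Adj y x) (s ++ a :: t).reverse := fun a => by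
    obtain ⟨t, ht⟩ := exists_isFinalChain_cons acyc a
    obtain ⟨s, hs⟩ := exists_isFinalChain_cons acyc' a
    exact ⟨s.reverse, t, isFinalChain_append_cons.2 ⟨ht, by simpa using hs⟩⟩
  refine ⟨{p | p ≠ [] ∧ IsFinalChain H.Adj p ∧ IsFinalChain (fun x y => H.Adj y x) p.reverse},
    ?_, ?_, ?_⟩
  · rintro p ⟨hne, hp, -⟩
    refine ⟨hne, ?_⟩
    have : p.IsChain (Relation.TransGen H.Adj) := hp.1.imp fun _ _ h => .single h
    exact this.pairwise.imp fun {a b} h => by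
      rintro rfl
      exact acyc a h
  · intro a
    obtain ⟨s, t, h⟩ := ex a
    refine ⟨s ++ a :: t, ⟨⟨by simp, h⟩, by simp⟩, ?_⟩
    rintro q ⟨⟨-, hq⟩, ha⟩
    obtain ⟨s', t', rfl⟩ := List.append_of_mem ha
    rw [isFinalChain_append_cons] at h hq
    have e₁ := hq.1.cons_unique out h.1
    have e₂ := hq.2.cons_unique inn h.2
    rw [e₁, List.reverse_injective e₂]
  · intro a b
    constructor
    · intro hab
      obtain ⟨s, t, h⟩ := ex a
      refine ⟨s ++ a :: t, ⟨by simp, h⟩, ?_⟩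
      have ht := (isFinalChain_append_cons.1 h).1
      cases t with
      | nil => exact (isFinalChain_singleton_iff.1 ht b hab).elim
      | cons c t =>
        obtain rfl := out a b c hab (IsFinalChain.cons_cons_iff.1 ht).1
        exact ⟨s, t, by simp⟩
    · rintro ⟨p, ⟨-, hp, -⟩, hab⟩
      simpa using hp.1.infix hab

lemma infix_pair_unique {α : Type u} {a b c : α} {p : List α} (hp : p.Nodup)
    (hb : [a, b] <:+: p) (hc : [a, c] <:+: p) : b = c := by
  induction p with
  | nil => simp at hb
  | cons x p ih =>
    rw [List.nodup_cons] at hp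
    rw [List.infix_cons_iff, List.cons_prefix_cons] at hb hc
    rcases hb with ⟨rfl, hb⟩ | hb <;> rcases hc with ⟨hx, hc⟩ | hc
    · cases p <;> simp_all
    · exact (hp.1 (hc.subset (by simp))).elim
    · exact (hp.1 (hb.subset (by simp [hx]))).elim
    · exact ih hp.2 hb hc

lemma infix_pair_asymm {α : Type u} {a b : α} {p : List α} (hp : p.Nodup)
    (h : [a, b] <:+: p) : ¬ [b, a] <:+: p := by
  induction p with
  | nil => simp at h
  | cons x p ih =>
    intro h'
    rw [List.nodup_cons] at hp
    rw [List.infix_cons_iff, List.cons_prefix_cons] at h h'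
    rcases h with ⟨rfl, h⟩ | h <;> rcases h' with ⟨hx, h'⟩ | h'
    · exact hp.1 (h'.subset (by simp))
    · exact hp.1 (h'.subset (by simp))
    · exact hp.1 (h.subset (by simp [hx]))
    · exact ih hp.2 h h'

lemma IsDisjointUnionOfPaths.out_unique {α : Type u} {H : Digraph α}
    (h : IsDisjointUnionOfPaths H) {a b c : α} (hab : H.Adj a b) (hac : H.Adj a c) : b = c := by
  obtain ⟨P, hP, hu, hadj⟩ := h
  obtain ⟨p, hp, hpab⟩ := (hadj a b).1 hab
  obtain ⟨q, hq, hqac⟩ := (hadj a c).1 hac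
  obtain rfl : p = q := (hu a).unique ⟨hp, hpab.subset (by simp)⟩ ⟨hq, hqac.subset (by simp)⟩
  exact infix_pair_unique (hP p hp).2 hpab hqac

lemma IsDisjointUnionOfPaths.asymm {α : Type u} {H : Digraph α}
    (h : IsDisjointUnionOfPaths H) {a b : α} (hab : H.Adj a b) : ¬ H.Adj b a := by
  intro hba
  obtain ⟨P, hP, hu, hadj⟩ := h
  obtain ⟨p, hp, hpab⟩ := (hadj a b).1 hab
  obtain ⟨q, hq, hqba⟩ := (hadj b a).1 hba
  obtain rfl : p = q := (hu a).unique ⟨hp, hpab.subset (by simp)⟩ ⟨hq, hqba.subset (by simp)⟩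
  exact infix_pair_asymm (hP p hp).2 hpab hqba

/-! ### Oriented graphs whose dependency digraph is not a union of paths -/

/-- Extends a digraph `E` on `Fin n`, placed on the vertices of `G` by `φ`, to an oriented graph
missing `G`: the other vertices dominate the image of `φ` wherever no edge of `G` forbids it, and
are oriented among themselves by a linear order. -/
def extendDigraph {V : Type u} [LinearOrder V] (G : SimpleGraph V) {n : ℕ} (E : Digraph (Fin n))
    (φ : Fin n → V) : Digraph V where
  Adj x y := x ≠ y ∧ ¬ G.Adj x y ∧
    ((∃ i j, φ i = x ∧ φ j = y ∧ E.Adj i j) ∨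
      (x ∉ Set.range φ ∧ (y ∈ Set.range φ ∨ x < y)))

lemma losesTo_map {V : Type u} {W : Type v} {E : Digraph V} {D : Digraph W} {φ : V → W}
    (hadj : ∀ i j, D.Adj (φ i) (φ j) ↔ E.Adj i j)
    (hout : ∀ i y, D.Adj (φ i) y → y ∈ Set.range φ) {e₁ e₂ : Sym2 V} (h : LosesTo E e₁ e₂) :
    LosesTo D (e₁.map φ) (e₂.map φ) := by
  -- Out-walks of `D` starting in the image of `φ` stay there.
  have key : ∀ x y, y ∉ outNbr E x ∪ secondOutNbr E x →
      φ y ∉ outNbr D (φ x) ∪ secondOutNbr D (φ x) := by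
    rintro x y hxy (h1 | ⟨hne, -, u, hu, huy⟩)
    · exact hxy (.inl ((hadj _ _).1 h1))
    · obtain ⟨k, rfl⟩ := hout _ _ hu
      refine hxy ?_
      by_cases hE : E.Adj x y
      · exact .inl hE
      · exact .inr ⟨fun h => hne (by rw [h]), hE, k, (hadj _ _).1 hu, (hadj _ _).1 huy⟩
  obtain ⟨x₁, y₁, x₂, y₂, rfl, rfl, h1, h2, h3, h4⟩ := h
  exact ⟨φ x₁, φ y₁, φ x₂, φ y₂, rfl, rfl, (hadj _ _).2 h1, key _ _ h2, (hadj _ _).2 h3,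
    key _ _ h4⟩

/-- A pattern `E` on an induced subgraph `H` of `G` extends to an oriented graph missing `G` that
keeps all losing relations of `E`. -/
lemma exists_extension {V : Type u} {G : SimpleGraph V} {n : ℕ} {H : SimpleGraph (Fin n)}
    (φ : H ↪g G) (E : Digraph (Fin n)) (hE : IsOriented E) (hH : missingGraph E = H) :
    ∃ D : Digraph V, IsOriented D ∧ IsMissing D G (Function.Embedding.refl V) ∧
      ∀ e₁ e₂ : Sym2 (Fin n), LosesTo E e₁ e₂ → LosesTo D (e₁.map φ) (e₂.map φ) := by
  classical
  let _ : LinearOrder V := linearOrderOfSTO WellOrderingRel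
  have inj := φ.injective
  have hHadj : ∀ i j, H.Adj i j ↔ i ≠ j ∧ ¬ E.Adj i j ∧ ¬ E.Adj j i := by
    rintro i j; rw [← hH]; rfl
  have hadj : ∀ i j, (extendDigraph G E φ).Adj (φ i) (φ j) ↔ E.Adj i j := by
    intro i j
    simp only [extendDigraph, inj.eq_iff, φ.map_adj_iff, hHadj, Set.mem_range_self, not_true,
      false_and, or_false, ne_eq]
    constructor
    · rintro ⟨-, -, a, b, rfl, rfl, h⟩; exact h
    · intro h
      exact ⟨by rintro rfl; exact hE.1 _ h, fun h' => h'.2.1 h, i, j, rfl, rfl, h⟩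
  refine ⟨extendDigraph G E φ, ⟨fun x h => h.1 rfl, ?_⟩, ?_, fun e₁ e₂ => losesTo_map hadj ?_⟩
  · intro x y hxy hyx
    by_cases hx : x ∈ Set.range φ <;> by_cases hy : y ∈ Set.range φ
    · obtain ⟨i, rfl⟩ := hx
      obtain ⟨j, rfl⟩ := hy
      exact hE.2 _ _ ((hadj _ _).1 hxy) ((hadj _ _).1 hyx)
    · rcases hxy.2.2 with ⟨i, j, rfl, rfl, -⟩ | h
      exacts [hy ⟨j, rfl⟩, h.1 hx]
    · rcases hyx.2.2 with ⟨i, j, rfl, rfl, -⟩ | h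
      exacts [hx ⟨j, rfl⟩, h.1 hy]
    · rcases hxy.2.2 with ⟨i, j, rfl, rfl, -⟩ | h
      · exact hx ⟨i, rfl⟩
      rcases hyx.2.2 with ⟨i, j, rfl, rfl, -⟩ | h'
      · exact hx ⟨j, rfl⟩
      exact lt_asymm (h.2.resolve_left hy) (h'.2.resolve_left hx)
  · unfold IsMissing
    ext x y
    have : (G.map (Function.Embedding.refl V)).Adj x y ↔ G.Adj x y := by simp
    rw [this]
    constructor
    · rintro ⟨hne, hxy, hyx⟩
      by_contra hG
      have hG' : ¬ G.Adj y x := fun h => hG h.symm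
      by_cases hx : x ∈ Set.range φ <;> by_cases hy : y ∈ Set.range φ
      · obtain ⟨i, rfl⟩ := hx
        obtain ⟨j, rfl⟩ := hy
        rw [hadj] at hxy hyx
        exact hG (φ.map_adj_iff.2 ((hHadj i j).2 ⟨fun h => hne (by rw [h]), hxy, hyx⟩))
      · exact hyx ⟨hne.symm, hG', .inr ⟨hy, .inl hx⟩⟩
      · exact hxy ⟨hne, hG, .inr ⟨hx, .inl hy⟩⟩
      · rcases lt_or_gt_of_ne hne with h | h
        · exact hxy ⟨hne, hG, .inr ⟨hx, .inr h⟩⟩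
        · exact hyx ⟨hne.symm, hG', .inr ⟨hy, .inr h⟩⟩
    · exact fun h => ⟨h.ne, fun h' => h'.2.1 h, fun h' => h'.2.1 h.symm⟩
  · rintro i y ⟨-, -, ⟨a, b, -, rfl, -⟩ | h⟩
    · exact ⟨b, rfl⟩
    · exact (h.1 ⟨i, rfl⟩).elim

/-- A sufficient criterion for the losing relation, in terms of arcs only. -/
lemma losesTo_of {W : Type u} {D : Digraph W} (x₁ y₁ x₂ y₂ : W)
    (h : D.Adj x₁ x₂ ∧ D.Adj y₁ y₂ ∧ ¬ D.Adj x₁ y₂ ∧ ¬ D.Adj y₁ x₂ ∧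
      (∀ u, D.Adj x₁ u → ¬ D.Adj u y₂) ∧ ∀ u, D.Adj y₁ u → ¬ D.Adj u x₂) :
    LosesTo D s(x₁, y₁) s(x₂, y₂) := by
  obtain ⟨h1, h2, h3, h4, h5, h6⟩ := h
  refine ⟨x₁, y₁, x₂, y₂, rfl, rfl, h1, ?_, h2, ?_⟩
  · rintro (h | ⟨-, -, u, hu, hu'⟩)
    exacts [h3 h, h5 u hu hu']
  · rintro (h | ⟨-, -, u, hu, hu'⟩)
    exacts [h4 h, h6 u hu hu']

instance : DecidableRel chair.Adj := by unfold chair; infer_instance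

/-- The digraph with the arcs in a given list. -/
def listDigraph {n : ℕ} (l : List (Fin n × Fin n)) : Digraph (Fin n) := ⟨fun i j => (i, j) ∈ l⟩

instance {n : ℕ} (l : List (Fin n × Fin n)) : DecidableRel (listDigraph l).Adj :=
  fun i j => inferInstanceAs (Decidable ((i, j) ∈ l))

lemma map_mem_edgeSet {V : Type u} {W : Type v} {D : Digraph W} {G : SimpleGraph V} {f : V ↪ W}
    (hD : IsMissing D G f) {a b : V} (h : G.Adj a b) : s(f a, f b) ∈ (missingGraph D).edgeSet := by
  rw [SimpleGraph.mem_edgeSet, hD]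
  exact SimpleGraph.map_adj_apply.2 h

/-- The vertices of an induced `2K₂` are oriented as a directed 4-cycle; its two edges then lose
to each other. -/
lemma not_coC4_of_paths {V : Type u} {G : SimpleGraph V}
    (h : ∀ D : Digraph V, IsOriented D → IsMissing D G (Function.Embedding.refl V) →
      IsDisjointUnionOfPaths (dependencyDigraph D)) :
    ¬ (SimpleGraph.cycleGraph 4)ᶜ ⊴ G := by
  rintro ⟨φ⟩
  obtain ⟨D, hD, hDG, hl⟩ := exists_extension φ
    (listDigraph [(0, 1), (1, 2), (2, 3), (3, 0)])
    (by unfold IsOriented; decide)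
    (by ext i j; revert i j; unfold missingGraph; decide)
  have h₁ := hl _ _ (losesTo_of 0 2 1 3 (by decide))
  have h₂ := hl _ _ (losesTo_of 1 3 2 0 (by decide))
  rw [Sym2.eq_swap (a := (2 : Fin 4))] at h₂
  have mem : ∀ i j, ((SimpleGraph.cycleGraph 4)ᶜ).Adj i j →
      s(φ i, φ j) ∈ (missingGraph D).edgeSet :=
    fun i j hij => map_mem_edgeSet hDG (φ.map_adj_iff.2 hij)
  exact (h D hD hDG).asymm (a := ⟨_, mem 0 2 (by decide)⟩) (b := ⟨_, mem 1 3 (by decide)⟩) h₁ h₂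

/-- An induced chair can be oriented so that its pendant edge at the vertex of degree two loses to
both other pendant edges. -/
lemma not_chair_of_paths {V : Type u} {G : SimpleGraph V}
    (h : ∀ D : Digraph V, IsOriented D → IsMissing D G (Function.Embedding.refl V) →
      IsDisjointUnionOfPaths (dependencyDigraph D)) :
    ¬ chair ⊴ G := by
  rintro ⟨φ⟩
  obtain ⟨D, hD, hDG, hl⟩ := exists_extension φ
    (listDigraph [(1, 3), (0, 2), (3, 0), (1, 4), (4, 0), (3, 4)])
    (by unfold IsOriented; decide)
    (by ext i j; revert i j; unfold missingGraph; decide)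
  have h₁ := hl _ _ (losesTo_of 1 0 3 2 (by decide))
  have h₂ := hl _ _ (losesTo_of 1 0 4 2 (by decide))
  have mem : ∀ i j, (chair).Adj i j → s(φ i, φ j) ∈ (missingGraph D).edgeSet :=
    fun i j hij => map_mem_edgeSet hDG (φ.map_adj_iff.2 hij)
  have := (h D hD hDG).out_unique (a := ⟨_, mem 1 0 (by decide)⟩)
    (b := ⟨_, mem 3 2 (by decide)⟩) (c := ⟨_, mem 4 2 (by decide)⟩) h₁ h₂
  simp [φ.injective.eq_iff] at this

/-- In the complement of the chair, the pendant edge can be made to lose to both edges at the vertex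
of degree two. In the labels of `chair`, the induced paths are `2, 0, 3, 1` and `2, 0, 4, 1`. -/
lemma not_coChair_of_paths {V : Type u} {G : SimpleGraph V}
    (h : ∀ D : Digraph V, IsOriented D → IsMissing D G (Function.Embedding.refl V) →
      IsDisjointUnionOfPaths (dependencyDigraph D)) :
    ¬ chairᶜ ⊴ G := by
  rintro ⟨φ⟩
  obtain ⟨D, hD, hDG, hl⟩ := exists_extension φ
    (listDigraph [(0, 1), (2, 3), (1, 2), (2, 4)])
    (by unfold IsOriented; decide)
    (by ext i j; revert i j; unfold missingGraph; decide)
  have h₁ := hl _ _ (losesTo_of 0 2 1 3 (by decide))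
  have h₂ := hl _ _ (losesTo_of 0 2 1 4 (by decide))
  have mem : ∀ i j, (chairᶜ).Adj i j → s(φ i, φ j) ∈ (missingGraph D).edgeSet :=
    fun i j hij => map_mem_edgeSet hDG (φ.map_adj_iff.2 hij)
  have := (h D hD hDG).out_unique (a := ⟨_, mem 0 2 (by decide)⟩)
    (b := ⟨_, mem 1 3 (by decide)⟩) (c := ⟨_, mem 1 4 (by decide)⟩) h₁ h₂
  simp [φ.injective.eq_iff] at this

/-! ### Simplicial vertices in combs -/

lemma indContained_of_lt {W : Type u} {M : SimpleGraph W} {n : ℕ} {H : SimpleGraph (Fin n)}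
    (w : Fin n → W)
    (h : ∀ i j, i < j → w i ≠ w j ∧ (M.Adj (w i) (w j) ↔ H.Adj i j)) : H ⊴ M := by
  refine ⟨⟨⟨w, fun i j hij => ?_⟩, fun {i j} => ?_⟩⟩
  · rcases lt_trichotomy i j with hlt | rfl | hlt
    exacts [((h i j hlt).1 hij).elim, rfl, ((h j i hlt).1 hij.symm).elim]
  · rcases lt_trichotomy i j with hlt | rfl | hlt
    · exact (h i j hlt).2
    · simp
    · rw [M.adj_comm, H.adj_comm]
      exact (h j i hlt).2

lemma indContained_of_map {V : Type u} {W : Type v} {G : SimpleGraph V} {f : V ↪ W} {n : ℕ}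
    {H : SimpleGraph (Fin n)} (hH : ∀ i, ∃ j, H.Adj i j) (h : H ⊴ G.map f) : H ⊴ G := by
  obtain ⟨φ⟩ := h
  have : ∀ i, ∃ a, f a = φ i := fun i => by
    obtain ⟨j, hj⟩ := hH i
    obtain ⟨-, a, b, -, ha, -⟩ := φ.map_adj_iff.2 hj
    exact ⟨a, ha⟩
  choose g hg using this
  refine ⟨⟨⟨g, fun i j hij => φ.injective (by rw [← hg, ← hg, hij])⟩, fun {i j} => ?_⟩⟩
  rw [← φ.map_adj_iff, ← hg, ← hg]
  exact SimpleGraph.map_adj_apply.symm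

/-- None of the five forbidden graphs has an isolated vertex, so adding isolated vertices to a comb
leaves it a comb. -/
lemma IsComb.map {V : Type u} {W : Type v} {G : SimpleGraph V} (h : IsComb G) (f : V ↪ W) :
    IsComb (G.map f) where
  noC4 h' := h.noC4 (indContained_of_map (by decide) h')
  noCoC4 h' := h.noCoC4 (indContained_of_map (by decide) h')
  noC5 h' := h.noC5 (indContained_of_map (by decide) h')
  noChair h' := h.noChair (indContained_of_map (by decide) h')
  noCoChair h' := h.noCoChair (indContained_of_map (by decide) h')

section Forbidden
variable {W : Type u} {M : SimpleGraph W}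

lemma IsComb.false_of_C4 (h : IsComb M) {a b c d : W} (ab : M.Adj a b) (bc : M.Adj b c)
    (cd : M.Adj c d) (da : M.Adj d a) (nac : ¬ M.Adj a c) (nbd : ¬ M.Adj b d) (hac : a ≠ c)
    (hbd : b ≠ d) : False := by
  refine h.noC4 (indContained_of_lt ![a, b, c, d] ?_)
  have := ab.ne; have := bc.ne; have := cd.ne; have := da.ne'; have := da.symm
  simp +decide [Fin.forall_fin_succ, *]

lemma IsComb.false_of_2K2 (h : IsComb M) {a b c d : W} (ab : M.Adj a b) (cd : M.Adj c d)
    (nac : ¬ M.Adj a c) (nad : ¬ M.Adj a d) (nbc : ¬ M.Adj b c) (nbd : ¬ M.Adj b d) : False := by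
  refine h.noCoC4 (indContained_of_lt ![a, c, b, d] ?_)
  have := ab.ne; have := cd.ne
  have : a ≠ c := by rintro rfl; exact nad cd
  have : a ≠ d := by rintro rfl; exact nac cd.symm
  have : c ≠ b := by rintro rfl; exact nbd cd
  have : b ≠ d := by rintro rfl; exact nbc cd.symm
  have : ¬ M.Adj c b := fun h => nbc h.symm
  simp +decide [Fin.forall_fin_succ, *]

lemma IsComb.false_of_C5 (h : IsComb M) {a b c d e : W} (ab : M.Adj a b) (bc : M.Adj b c)
    (cd : M.Adj c d) (de : M.Adj d e) (ea : M.Adj e a) (nac : ¬ M.Adj a c) (nad : ¬ M.Adj a d)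
    (nbd : ¬ M.Adj b d) (nbe : ¬ M.Adj b e) (nce : ¬ M.Adj c e) : False := by
  refine h.noC5 (indContained_of_lt ![a, b, c, d, e] ?_)
  have := ab.ne; have := bc.ne; have := cd.ne; have := de.ne; have := ea.ne'; have := ea.symm
  have : a ≠ c := by rintro rfl; exact nad cd
  have : a ≠ d := by rintro rfl; exact nac cd.symm
  have : b ≠ d := by rintro rfl; exact nbe de
  have : b ≠ e := by rintro rfl; exact nbd de.symm
  have : c ≠ e := by rintro rfl; exact nac ea.symm
  simp +decide [Fin.forall_fin_succ, *]

/-- The vertices `a, b, c, d` in this order form an induced path. -/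
structure IsInducedP4 (M : SimpleGraph W) (a b c d : W) : Prop where
  ab : M.Adj a b
  bc : M.Adj b c
  cd : M.Adj c d
  nac : ¬ M.Adj a c
  nad : ¬ M.Adj a d
  nbd : ¬ M.Adj b d

lemma IsInducedP4.symm {a b c d : W} (p : IsInducedP4 M a b c d) : IsInducedP4 M d c b a :=
  ⟨p.cd.symm, p.bc.symm, p.ab.symm, fun h => p.nbd h.symm, fun h => p.nad h.symm,
    fun h => p.nac h.symm⟩

lemma IsInducedP4.ne {a b c d : W} (p : IsInducedP4 M a b c d) :
    a ≠ c ∧ a ≠ d ∧ b ≠ d :=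
  ⟨by rintro rfl; exact p.nad p.cd, by rintro rfl; exact p.nac p.cd.symm,
    by rintro rfl; exact p.nad p.ab⟩

lemma IsComb.false_of_chair (h : IsComb M) {a b c d d' : W} (p : IsInducedP4 M a b c d)
    (cd' : M.Adj c d') (nad' : ¬ M.Adj a d') (nbd' : ¬ M.Adj b d') (ndd' : ¬ M.Adj d d')
    (hdd' : d ≠ d') : False := by
  refine h.noChair (indContained_of_lt ![a, b, c, d, d'] ?_)
  obtain ⟨ab, bc, cd, nac, nad, nbd⟩ := id p
  obtain ⟨h1, h2, h3⟩ := p.ne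
  have := ab.ne; have := bc.ne; have := cd.ne; have := cd'.ne
  have : a ≠ d' := by rintro rfl; exact nac cd'.symm
  have : b ≠ d' := by rintro rfl; exact nad' ab
  simp +decide [Fin.forall_fin_succ, *]

lemma IsComb.false_of_coChair (h : IsComb M) {a b c d c' : W} (p : IsInducedP4 M a b c d)
    (bc' : M.Adj b c') (cc' : M.Adj c c') (dc' : M.Adj d c') (nac' : ¬ M.Adj a c') : False := by
  refine h.noCoChair (indContained_of_lt ![b, d, a, c, c'] ?_)
  obtain ⟨ab, bc, cd, nac, nad, nbd⟩ := id p
  obtain ⟨h1, h2, h3⟩ := p.ne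
  have := ab.ne'; have := bc.ne; have := cd.ne'; have := cc'.ne; have := bc'.ne; have := dc'.ne
  have : a ≠ c' := by rintro rfl; exact nad dc'.symm
  have := ab.symm; have := cd.symm; have := h2.symm; have nda : ¬ M.Adj d a := fun h => nad h.symm
  simp +decide [Fin.forall_fin_succ, *]

/-- A vertex is simplicial if its neighbors are pairwise adjacent. -/
def IsSimplicial (M : SimpleGraph W) (a : W) : Prop :=
  ∀ p q, M.Adj a p → M.Adj a q → p ≠ q → M.Adj p q

/-- Every other neighbor of the end of an induced path `P₄` is adjacent to both inner vertices. -/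
lemma IsComb.adj_inner (h : IsComb M) {a b c d p : W} (P : IsInducedP4 M a b c d)
    (hp : M.Adj a p) (hpb : p ≠ b) : M.Adj p b ∧ M.Adj p c := by
  obtain ⟨ab, bc, cd, nac, nad, nbd⟩ := id P
  obtain ⟨h1, h2, h3⟩ := P.ne
  have hpc : p ≠ c := by rintro rfl; exact nac hp
  have hpb' : M.Adj p b := by
    by_contra n
    have npc : ¬ M.Adj p c := fun pc =>
      h.false_of_C4 ab bc pc.symm hp.symm nac (fun h => n h.symm) h1 hpb.symm
    by_cases pd : M.Adj p d
    · exact h.false_of_C5 ab bc cd pd.symm hp.symm nac nad nbd (fun h => n h.symm)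
        (fun h => npc h.symm)
    · exact h.false_of_2K2 hp cd nac nad npc pd
  refine ⟨hpb', ?_⟩
  by_contra npc
  by_cases pd : M.Adj p d
  · exact h.false_of_C4 hpb' bc cd pd.symm npc nbd hpc h3
  · exact h.false_of_2K2 hp cd nac nad npc pd

lemma IsComb.isSimplicial (h : IsComb M) {a b c d : W} (P : IsInducedP4 M a b c d) :
    IsSimplicial M a := by
  intro p q hp hq hpq
  by_cases hpb : p = b
  · subst hpb
    exact (h.adj_inner P hq hpq.symm).1.symm
  by_cases hqb : q = b
  · subst hqb
    exact (h.adj_inner P hp hpq).1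
  by_contra n
  exact h.false_of_C4 hp (h.adj_inner P hp hpb).2 (h.adj_inner P hq hqb).2.symm hq.symm P.nac n
    P.ne.1 hpq

lemma IsInducedP4.not_isSimplicial {a b c d : W} (P : IsInducedP4 M a b c d) :
    ¬ IsSimplicial M b := fun h => P.nac (h a c P.ab.symm P.bc P.ne.1)

/-- No simplicial vertex is adjacent to the end of an induced path `P₄`. -/
lemma IsComb.not_adj_of_isSimplicial (h : IsComb M) {a b c d p : W} (P : IsInducedP4 M a b c d)
    (hp : IsSimplicial M p) : ¬ M.Adj a p := by
  intro hap
  have hpb : p ≠ b := by rintro rfl; exact P.not_isSimplicial hp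
  exact P.nac (hp a c hap.symm (h.adj_inner P hap hpb).2 P.ne.1)

end Forbidden

/-! ### The losing relation when the missing edges form a comb -/

section Losing
variable {W : Type u} {D : Digraph W}

/-- The arc structure behind the missing edge `ab` losing to the missing edge `cd`: the four
vertices form an induced path of the missing graph, oriented by `b → d`, `a → c`, `d → a`, and
there is no directed 2-path from `b` to `c` or from `a` to `d`. -/
structure LosesAlong (D : Digraph W) (a b c d : W) : Prop where
  path : IsInducedP4 (missingGraph D) a b c d
  bd : D.Adj b d
  ac : D.Adj a c
  da : D.Adj d a
  no_bc : ∀ u, D.Adj b u → ¬ D.Adj u c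
  no_ad : ∀ u, D.Adj a u → ¬ D.Adj u d

lemma missingGraph_adj {x y : W} : (missingGraph D).Adj x y ↔ x ≠ y ∧ ¬ D.Adj x y ∧ ¬ D.Adj y x :=
  Iff.rfl

lemma LosesTo.exists_losesAlong (hD : IsOriented D) (hM : IsComb (missingGraph D)) {e₁ e₂ : Sym2 W}
    (h₁ : e₁ ∈ (missingGraph D).edgeSet) (h₂ : e₂ ∈ (missingGraph D).edgeSet)
    (h : LosesTo D e₁ e₂) :
    ∃ a b c d, e₁ = s(a, b) ∧ e₂ = s(c, d) ∧ LosesAlong D a b c d := by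
  obtain ⟨x₁, y₁, x₂, y₂, rfl, rfl, hx, hxy, hy, hyx⟩ := h
  rw [SimpleGraph.mem_edgeSet] at h₁ h₂
  have nx : x₁ ≠ y₂ := by rintro rfl; exact h₁.2.2 hy
  have ny : y₁ ≠ x₂ := by rintro rfl; exact h₁.2.1 hx
  have nx' : ¬ D.Adj x₁ y₂ := fun h => hxy (.inl h)
  have ny' : ¬ D.Adj y₁ x₂ := fun h => hyx (.inl h)
  have sx : ∀ u, D.Adj x₁ u → ¬ D.Adj u y₂ := fun u h h' =>
    hxy (.inr ⟨nx.symm, nx', u, h, h'⟩)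
  have sy : ∀ u, D.Adj y₁ u → ¬ D.Adj u x₂ := fun u h h' =>
    hyx (.inr ⟨ny.symm, ny', u, h, h'⟩)
  have mx : ¬ (missingGraph D).Adj x₁ x₂ := fun h => h.2.1 hx
  have my : ¬ (missingGraph D).Adj y₁ y₂ := fun h => h.2.1 hy
  -- The diagonals `x₁y₂` and `y₁x₂` are not both missing (`C₄`), and one of them is (`2K₂`).
  by_cases m₁ : (missingGraph D).Adj x₁ y₂ <;> by_cases m₂ : (missingGraph D).Adj y₁ x₂
  · exact (hM.false_of_C4 h₁ m₂ h₂ m₁.symm mx my (fun h => hD.1 _ (h ▸ hx))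
      (fun h => hD.1 _ (h ▸ hy))).elim
  · have : D.Adj x₂ y₁ := by
      rw [missingGraph_adj] at m₂
      tauto
    exact ⟨y₁, x₁, y₂, x₂, Sym2.eq_swap, Sym2.eq_swap,
      ⟨h₁.symm, m₁, h₂.symm, my, m₂, mx⟩, hx, hy, this, sx, sy⟩
  · have : D.Adj y₂ x₁ := by
      rw [missingGraph_adj] at m₁
      tauto
    exact ⟨x₁, y₁, x₂, y₂, rfl, rfl, ⟨h₁, m₂, h₂, mx, m₁, my⟩, hy, hx, this, sy, sx⟩
  · exact (hM.false_of_2K2 h₁ h₂ mx m₁ m₂ my).elim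

/-- A simplicial end and a nonsimplicial end determine the naming of the end vertices of an edge. -/
lemma edge_eq_of_isSimplicial {M : SimpleGraph W} {a b a' b' : W} (h : s(a, b) = s(a', b'))
    (ha : IsSimplicial M a) (hb' : ¬ IsSimplicial M b') : a = a' ∧ b = b' := by
  rcases Sym2.eq_iff.1 h with h | ⟨rfl, rfl⟩
  exacts [h, (hb' ha).elim]

lemma adj_or_adj {x y : W} (hne : x ≠ y) (h : ¬ (missingGraph D).Adj x y) :
    D.Adj x y ∨ D.Adj y x := by
  rw [missingGraph_adj] at h
  tauto

lemma LosesAlong.out_unique (hM : IsComb (missingGraph D)) {a b c d c' d' : W}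
    (h : LosesAlong D a b c d) (h' : LosesAlong D a b c' d') : c = c' ∧ d = d' := by
  have sd := hM.isSimplicial h.path.symm
  have sd' := hM.isSimplicial h'.path.symm
  have ndd' := hM.not_adj_of_isSimplicial h.path.symm sd'
  by_cases hd : d = d'
  · subst hd
    refine ⟨?_, rfl⟩
    by_contra hc
    exact hM.false_of_coChair h.path h'.path.bc (sd c c' h.path.cd.symm h'.path.cd.symm hc)
      h'.path.cd.symm h'.path.nac
  · exfalso
    by_cases cd' : (missingGraph D).Adj c d'
    · exact hM.false_of_chair h.path cd' h'.path.nad h'.path.nbd ndd' hd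
    · have hcd' : c ≠ d' := by rintro rfl; exact h'.path.nbd h.path.bc
      rcases adj_or_adj hcd' cd' with hcd | hcd
      · exact h'.no_ad c h.ac hcd
      · exact h.no_bc d' h'.bd hcd

lemma LosesAlong.in_unique (hM : IsComb (missingGraph D)) {a b a' b' c d : W}
    (h : LosesAlong D a b c d) (h' : LosesAlong D a' b' c d) : a = a' ∧ b = b' := by
  have sa := hM.isSimplicial h.path
  have sa' := hM.isSimplicial h'.path
  have naa' := hM.not_adj_of_isSimplicial h.path sa'
  by_cases ha : a = a'
  · subst ha
    refine ⟨rfl, ?_⟩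
    by_contra hb
    exact hM.false_of_coChair h.path.symm h'.path.bc.symm (sa b b' h.path.ab h'.path.ab hb)
      h'.path.ab (fun h => h'.path.nbd h.symm)
  · exfalso
    by_cases ab' : (missingGraph D).Adj a b'
    · exact hM.false_of_chair h'.path.symm ab'.symm (fun h' => h.path.nad h'.symm)
        (fun h' => h.path.nac h'.symm) (fun h => naa' h.symm) (fun h => ha h.symm)
    · have hab' : a ≠ b' := by rintro rfl; exact h.path.nac h'.path.bc
      rcases adj_or_adj hab' ab' with hab | hab
      · exact h.no_ad b' hab h'.bd
      · exact h'.no_bc a hab h.ac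

/-- Along a directed walk of losing edges, the simplicial end of the last edge dominates the
simplicial end of the first one. This is what rules out directed cycles. -/
lemma exists_adj_of_transGen (hD : IsOriented D) (hM : IsComb (missingGraph D))
    {e e' : (missingGraph D).edgeSet} (h : Relation.TransGen (dependencyDigraph D).Adj e e') :
    ∃ a b c d, (e : Sym2 W) = s(a, b) ∧ (e' : Sym2 W) = s(c, d) ∧
      IsSimplicial (missingGraph D) a ∧ ¬ IsSimplicial (missingGraph D) b ∧
      IsSimplicial (missingGraph D) d ∧ ¬ IsSimplicial (missingGraph D) c ∧ D.Adj d a := by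
  induction h with
  | @single e' h =>
    obtain ⟨a, b, c, d, he, he', hl⟩ := LosesTo.exists_losesAlong hD hM e.2 e'.2 h
    exact ⟨a, b, c, d, he, he', hM.isSimplicial hl.path, hl.path.not_isSimplicial,
      hM.isSimplicial hl.path.symm, hl.path.symm.not_isSimplicial, hl.da⟩
  | @tail e' e'' _ h ih =>
    obtain ⟨a, b, c, d, he, he', sa, nb, sd, nc, hda⟩ := ih
    obtain ⟨d', c', p, q, he₁, he₂, hl⟩ := LosesTo.exists_losesAlong hD hM e'.2 e''.2 h
    obtain ⟨rfl, rfl⟩ := edge_eq_of_isSimplicial ((Sym2.eq_swap.trans he'.symm).trans he₁) sd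
      hl.path.not_isSimplicial
    refine ⟨a, b, p, q, he, he₂, sa, nb, hM.isSimplicial hl.path.symm,
      hl.path.symm.not_isSimplicial, ?_⟩
    -- Otherwise `a → q`, and `d → a → q` contradicts that `q` is not a second out-neighbor of `d`.
    have hqa : q ≠ a := by rintro rfl; exact hD.2 _ _ hda hl.da
    exact (adj_or_adj hqa (hM.not_adj_of_isSimplicial hl.path.symm sa)).resolve_right
      (hl.no_ad a hda)

lemma isDisjointUnionOfPaths_of_isComb [Finite W] (hD : IsOriented D)
    (hM : IsComb (missingGraph D)) : IsDisjointUnionOfPaths (dependencyDigraph D) := by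
  apply isDisjointUnionOfPaths_of_acyclic
  · intro e e₁ e₂ h₁ h₂
    obtain ⟨a, b, c, d, he, he₁, hl⟩ := LosesTo.exists_losesAlong hD hM e.2 e₁.2 h₁
    obtain ⟨a', b', c', d', he', he₂, hl'⟩ := LosesTo.exists_losesAlong hD hM e.2 e₂.2 h₂
    obtain ⟨rfl, rfl⟩ := edge_eq_of_isSimplicial (he.symm.trans he') (hM.isSimplicial hl.path)
      hl'.path.not_isSimplicial
    obtain ⟨rfl, rfl⟩ := hl.out_unique hM hl'
    exact Subtype.ext (he₁.trans he₂.symm)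
  · intro e e₁ e₂ h₁ h₂
    obtain ⟨a, b, c, d, he₁, he, hl⟩ := LosesTo.exists_losesAlong hD hM e₁.2 e.2 h₁
    obtain ⟨a', b', c', d', he₂, he', hl'⟩ := LosesTo.exists_losesAlong hD hM e₂.2 e.2 h₂
    obtain ⟨rfl, rfl⟩ := edge_eq_of_isSimplicial
      (Sym2.eq_swap.trans ((he.symm.trans he').trans Sym2.eq_swap))
      (hM.isSimplicial hl.path.symm) hl'.path.symm.not_isSimplicial
    obtain ⟨rfl, rfl⟩ := hl.in_unique hM hl'
    exact Subtype.ext (he₁.trans he₂.symm)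
  · intro e h
    obtain ⟨a, b, c, d, he, he', sa, -, -, nc, hda⟩ := exists_adj_of_transGen hD hM h
    obtain ⟨rfl, -⟩ := edge_eq_of_isSimplicial (he.symm.trans (he'.trans Sym2.eq_swap)) sa nc
    exact hD.1 _ hda

end Losing

end MissingComb

theorem mainTheorem2 {V : Type u} [Finite V] (G : SimpleGraph V)
    (hC4 : ¬ SimpleGraph.IsIndContained (SimpleGraph.cycleGraph 4) G)
    (hC5 : ¬ SimpleGraph.IsIndContained (SimpleGraph.cycleGraph 5) G) :
    (∀ (W : Type u) [Finite W] (D : Digraph W) (f : V ↪ W),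
        MissingComb.IsOriented D → MissingComb.IsMissing D G f →
          MissingComb.IsDisjointUnionOfPaths (MissingComb.dependencyDigraph D)) ↔
      MissingComb.IsComb G := by
  constructor
  · intro h
    have h' : ∀ D : Digraph V, MissingComb.IsOriented D →
        MissingComb.IsMissing D G (Function.Embedding.refl V) →
        MissingComb.IsDisjointUnionOfPaths (MissingComb.dependencyDigraph D) :=
      fun D hD hDG => h V D _ hD hDG
    exact ⟨hC4, MissingComb.not_coC4_of_paths h', hC5, MissingComb.not_chair_of_paths h',
      MissingComb.not_coChair_of_paths h'⟩
  · intro hG W _ D f hD hDG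
    refine MissingComb.isDisjointUnionOfPaths_of_isComb hD ?_
    have : MissingComb.missingGraph D = G.map f := hDG
    rw [this]
    exact hG.map f
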